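/- Let $\Sigma$ be a finite nonempty set and let $P=(P_{ij})_{i,j\in\Sigma}$ be a (row-)stochastic matrix. Assume that $P$ is irreducible and periodic with period $2$; that is, for every $i\in\Sigma$ the greatest common divisor of $\{n\ge 1:(P^n)_{ii}>0\}$ is $2$. Then $P$ has a unique stationary distribution $\pi$ (a probability row vector with $\pi P=\pi$), and the following strong law of large numbers holds. Let $w$ be any real-valued function on $\Sigma\times\Sigma$, let $W:=(w(i,j))_{i,j\in\Sigma}$ be the payoff matrix, and put $$\mu:=\pi\dot P\mathbf 1,$$ where $\dot P:=P\circ W$ is the Hadamard (entrywise) product and $\mathbf 1$ is the column vector of ones indexed by $\Sigma$. Let $\{X_n\}_{n\ge0}$ be a Markov chain in $\Sigma$ with transition matrix $P$ and arbitrary initial distribution, and let $S_n:=\sum_{k=1}^n w(X_{k-1},X_k)$ for $n\ge1$. Then $$\lim_{n\to\infty}n^{-1}S_n=\mu\quad\text{a.s.}$$ -/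

import Mathlib

open MeasureTheory Filter Topology
open scoped Matrix

noncomputable section

namespace FiniteMarkov

variable {S : Type*} [Fintype S] [DecidableEq S]

/-- Every state of the chain with transition matrix `P` has period `d`: for each state `i`, the
number `d` is the greatest common divisor of the set of `n ≥ 1` with `(P ^ n) i i > 0`. -/
def HasPeriod (P : Matrix S S ℝ) (d : ℕ) : Prop :=
  ∀ i : S, (∀ n : ℕ, 1 ≤ n → 0 < (P ^ n) i i → d ∣ n) ∧
    ∀ c : ℕ, (∀ n : ℕ, 1 ≤ n → 0 < (P ^ n) i i → c ∣ n) → c ∣ d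

/-- The row vector `π` is a probability vector with `π P = π`. -/
def IsStationary (P : Matrix S S ℝ) (π : S → ℝ) : Prop :=
  π ∈ stdSimplex ℝ S ∧ π ᵥ* P = π

/-- `X 0, X 1, …` is a Markov chain with transition matrix `P`, on the probability space
`(Ω, μ)`. The second field is the Markov property
`μ (X (n + 1) = x (n + 1) | X 0 = x 0, …, X n = x n) = P (x n) (x (n + 1))`, multiplied out so that
it is also meaningful (and trivially true) when the conditioning event is null. Nothing is required
of the distribution of `X 0`: the initial distribution is arbitrary. -/
structure IsMarkovChain {Ω : Type*} [MeasurableSpace Ω] [MeasurableSpace S]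
    (P : Matrix S S ℝ) (μ : Measure Ω) (X : ℕ → Ω → S) : Prop where
  measurable : ∀ n, Measurable (X n)
  markov : ∀ (n : ℕ) (x : ℕ → S),
    μ.real {ω | ∀ k ≤ n + 1, X k ω = x k} =
      μ.real {ω | ∀ k ≤ n, X k ω = x k} * P (x n) (x (n + 1))

/-- The cumulative payoff `S_n = w(X_0, X_1) + ⋯ + w(X_{n-1}, X_n)`, where the payoff function `w`
is given by the payoff matrix `W`. -/
def cumulativePayoff {Ω : Type*} (W : Matrix S S ℝ) (X : ℕ → Ω → S) (n : ℕ) (ω : Ω) : ℝ :=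
  ∑ k ∈ Finset.range n, W (X k ω) (X (k + 1) ω)

/-- The mean payoff `π Ṗ 1`, where `Ṗ = P ∘ W` is the Hadamard (entrywise) product and `1` is the
column vector of ones. -/
def meanPayoff (P W : Matrix S S ℝ) (π : S → ℝ) : ℝ :=
  π ⬝ᵥ ((P ⊙ W) *ᵥ 1)

end FiniteMarkov

end

/-!
Let `m` be the mean payoff. A solution `g` of the Poisson equation `g - P g = Ṗ 1 - m` splits the
payoffs as `w(i, j) - m = h(i, j) - (g(j) - g(i))`, where `h` has mean zero under every row of `P`
and the increments of `g` telescope to a bounded term. The equation is solvable because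
`1 - P + 1 π` is invertible as soon as all harmonic functions are constant, which the maximum
principle gives for irreducible `P`.

By the Markov property the variables `h(X_k, X_{k+1})` are orthogonal in `L²`, so their sums `T_n`
satisfy `E ‖T_n‖² = O(n)`. Hence `T_{n²} / n²` has square-summable `L²` norms and tends to `0`
almost surely; so do the absolute sums over the blocks `[n², (n + 1)²)` of length `2 n + 1`,
divided by `n²`, which fills in the times between consecutive squares.
-/

namespace FiniteMarkov

section StochasticMatrix

open Matrix

variable {R S : Type*} [Fintype S]

theorem exists_vecMul_eq_self_of_mulVec_eq_self [CommRing R] [IsDomain R] {A : Matrix S S R}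
    {u : S → R} (hu₀ : u ≠ 0) (hu : A *ᵥ u = u) : ∃ v : S → R, v ≠ 0 ∧ v ᵥ* A = v := by
  classical
  have hdet : (A - 1).det = 0 :=
    exists_mulVec_eq_zero_iff.1 ⟨u, hu₀, by rw [sub_mulVec, hu, one_mulVec, sub_self]⟩
  obtain ⟨v, hv₀, hv⟩ := exists_vecMul_eq_zero_iff.2 hdet
  exact ⟨v, hv₀, by rwa [vecMul_sub, vecMul_one, sub_eq_zero] at hv⟩

variable [DecidableEq S]

theorem pow_mulVec_eq_self [Semiring R] {A : Matrix S S R} {g : S → R} (hg : A *ᵥ g = g) (k : ℕ) :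
    (A ^ k) *ᵥ g = g := by
  induction k with
  | zero => rw [pow_zero, one_mulVec]
  | succ k ih => rw [pow_succ, ← mulVec_mulVec, hg, ih]

variable [Ring R] [LinearOrder R] [IsStrictOrderedRing R] {P : Matrix S S R}

theorem eq_of_mulVec_apply_eq_of_forall_le (hP : P ∈ rowStochastic R S) {g : S → R} {i j : S}
    (hg : (P *ᵥ g) i = g i) (hmax : ∀ k, g k ≤ g i) (hij : 0 < P i j) : g j = g i := by
  have hsum : ∑ k, P i k * g k = ∑ k, P i k * g i := by
    rw [← Finset.sum_mul, sum_row_of_mem_rowStochastic hP, one_mul]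
    exact hg
  have hle : ∀ k ∈ Finset.univ, P i k * g k ≤ P i k * g i := fun k _ =>
    mul_le_mul_of_nonneg_left (hmax k) (hP.1 i k)
  exact mul_left_cancel₀ hij.ne'
    ((Finset.sum_eq_sum_iff_of_le hle).1 hsum j (Finset.mem_univ j))

theorem abs_vecMul_eq_self (hP : P ∈ rowStochastic R S) {v : S → R} (hv : v ᵥ* P = v) :
    |v| ᵥ* P = |v| := by
  have hle : ∀ j ∈ Finset.univ, |v| j ≤ (|v| ᵥ* P) j := fun j _ => by
    calc |v| j = |∑ i, v i * P i j| := congrArg abs (congrFun hv j).symm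
      _ ≤ ∑ i, |v i * P i j| := Finset.abs_sum_le_sum_abs _ _
      _ = (|v| ᵥ* P) j := by
        simp only [vecMul, dotProduct, Pi.abs_apply, abs_mul, abs_of_nonneg (hP.1 _ _)]
  have hsum : ∑ j, |v| j = ∑ j, (|v| ᵥ* P) j := by
    rw [← dotProduct_one, ← dotProduct_one, ← dotProduct_mulVec, hP.2]
  funext j
  exact ((Finset.sum_eq_sum_iff_of_le hle).1 hsum j (Finset.mem_univ j)).symm

end StochasticMatrix

section Stationary

open Matrix

variable {S : Type*} [Fintype S] {P : Matrix S S ℝ} {π ρ : S → ℝ}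

theorem IsStationary.dotProduct_one (hπ : IsStationary P π) : π ⬝ᵥ (1 : S → ℝ) = 1 := by
  exact (_root_.dotProduct_one π).trans hπ.1.2

theorem exists_isStationary [DecidableEq S] [Nonempty S] (hP : P ∈ rowStochastic ℝ S) :
    ∃ π : S → ℝ, IsStationary P π := by
  obtain ⟨v, hv₀, hv⟩ := exists_vecMul_eq_self_of_mulVec_eq_self one_ne_zero hP.2
  obtain ⟨i, hi⟩ := Function.ne_iff.1 hv₀
  have hpos : 0 < ∑ j, |v| j :=
    Finset.sum_pos' (fun j _ => abs_nonneg (v j)) ⟨i, Finset.mem_univ i, abs_pos.2 hi⟩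
  refine ⟨(∑ j, |v| j)⁻¹ • |v|, ⟨fun j => ?_, ?_⟩, ?_⟩
  · exact mul_nonneg (inv_nonneg.2 hpos.le) (abs_nonneg (v j))
  · simp only [Pi.smul_apply, smul_eq_mul, ← Finset.mul_sum]
    exact inv_mul_cancel₀ hpos.ne'
  · rw [smul_vecMul, abs_vecMul_eq_self hP hv]

/-- The Liouville property of the chain with transition matrix `P`: every harmonic function, that
is, every column vector `g` with `P g = g`, is constant. For finite chains it says that there is
only one recurrent class, so it is weaker than irreducibility. -/
def HasLiouvilleProperty (P : Matrix S S ℝ) : Prop :=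
  ∀ g : S → ℝ, P *ᵥ g = g → ∀ i j, g i = g j

theorem hasLiouvilleProperty_of_isIrreducible [DecidableEq S] (hP : P ∈ rowStochastic ℝ S)
    (hirr : P.IsIrreducible) : HasLiouvilleProperty P := by
  intro g hg i j
  have : Nonempty S := ⟨i⟩
  obtain ⟨m, hm⟩ := Finite.exists_max g
  have hconst : ∀ l, g l = g m := fun l => by
    obtain ⟨k, -, hk⟩ := (isIrreducible_iff_exists_pow_pos hP.1).1 hirr m l
    exact eq_of_mulVec_apply_eq_of_forall_le (pow_mem hP k)
      (congrFun (pow_mulVec_eq_self hg k) m) hm hk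
  rw [hconst i, hconst j]

/-- The matrix `1 - P + 1 π`, where `1 π` is the matrix all of whose rows are `π`. It is invertible
when `1 - P` is not, and its inverse, the Kemeny–Snell fundamental matrix, solves the Poisson
equation. -/
def poissonMatrix [DecidableEq S] (P : Matrix S S ℝ) (π : S → ℝ) : Matrix S S ℝ :=
  1 - P + vecMulVec 1 π

theorem poissonMatrix_mulVec [DecidableEq S] (P : Matrix S S ℝ) (π g : S → ℝ) :
    poissonMatrix P π *ᵥ g = g - P *ᵥ g + (π ⬝ᵥ g) • (1 : S → ℝ) := by
  rw [poissonMatrix, add_mulVec, sub_mulVec, one_mulVec, vecMulVec_mulVec, op_smul_eq_smul]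

theorem IsStationary.vecMul_poissonMatrix [DecidableEq S] (hρ : IsStationary P ρ)
    (π : S → ℝ) : ρ ᵥ* poissonMatrix P π = π := by
  rw [poissonMatrix, vecMul_add, vecMul_sub, vecMul_one, hρ.2, sub_self, zero_add,
    vecMul_vecMulVec, hρ.dotProduct_one, one_smul]

theorem isUnit_poissonMatrix [DecidableEq S] (hL : HasLiouvilleProperty P)
    (hπ : IsStationary P π) : IsUnit (poissonMatrix P π) := by
  rw [← mulVec_injective_iff_isUnit]
  refine (injective_iff_map_eq_zero (poissonMatrix P π).mulVecLin).2 fun g hg => ?_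
  rw [mulVecLin_apply] at hg
  have hmean : π ⬝ᵥ g = 0 := by
    rw [← hπ.vecMul_poissonMatrix π, ← dotProduct_mulVec, hg, dotProduct_zero]
  have hharm : P *ᵥ g = g := by
    rw [poissonMatrix_mulVec, hmean, zero_smul, add_zero, sub_eq_zero] at hg
    exact hg.symm
  funext i
  have hconst : g = g i • 1 := by
    funext j
    simpa using hL g hharm j i
  rwa [hconst, dotProduct_smul, hπ.dotProduct_one, smul_eq_mul, mul_one] at hmean

theorem IsStationary.eq (hL : HasLiouvilleProperty P) (hπ : IsStationary P π)
    (hρ : IsStationary P ρ) : ρ = π := by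
  classical
  exact vecMul_injective_of_isUnit (isUnit_poissonMatrix hL hπ)
    ((hρ.vecMul_poissonMatrix π).trans (hπ.vecMul_poissonMatrix π).symm)

theorem existsUnique_isStationary [DecidableEq S] [Nonempty S] (hP : P ∈ rowStochastic ℝ S)
    (hL : HasLiouvilleProperty P) : ∃! π : S → ℝ, IsStationary P π := by
  obtain ⟨π, hπ⟩ := exists_isStationary hP
  exact ⟨π, hπ, fun _ hρ => hπ.eq hL hρ⟩

theorem exists_poisson_solution (hL : HasLiouvilleProperty P) (hπ : IsStationary P π) (f : S → ℝ) :
    ∃ g : S → ℝ, g - P *ᵥ g = f - (π ⬝ᵥ f) • (1 : S → ℝ) := by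
  classical
  obtain ⟨g, rfl⟩ := mulVec_surjective_iff_isUnit.2 (isUnit_poissonMatrix hL hπ) f
  refine ⟨g, ?_⟩
  rw [dotProduct_mulVec, hπ.vecMul_poissonMatrix, poissonMatrix_mulVec, add_sub_cancel_right]

end Stationary

section Averages

variable {E : Type*}

theorem norm_sum_range_le_norm_sum_range_sqrt_sq [SeminormedAddCommGroup E] (u : ℕ → E) (n : ℕ) :
    ‖∑ k ∈ Finset.range n, u k‖ ≤ ‖∑ k ∈ Finset.range (n.sqrt ^ 2), u k‖ +
      ∑ k ∈ Finset.Ico (n.sqrt ^ 2) ((n.sqrt + 1) ^ 2), ‖u k‖ := by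
  have hlow : n.sqrt ^ 2 ≤ n := n.sqrt_le'
  rw [← Finset.sum_range_add_sum_Ico u hlow]
  refine (norm_add_le _ _).trans (add_le_add_right ((norm_sum_le _ _).trans ?_) _)
  exact Finset.sum_le_sum_of_subset_of_nonneg
    (Finset.Ico_subset_Ico_right n.lt_succ_sqrt'.le) fun _ _ _ => norm_nonneg _

theorem tendsto_average_zero_of_tendsto_sq [NormedAddCommGroup E] [NormedSpace ℝ E] {u : ℕ → E}
    (hsq : Tendsto (fun m : ℕ => ((m : ℝ) ^ 2)⁻¹ • ∑ k ∈ Finset.range (m ^ 2), u k) atTop (𝓝 0))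
    (hblock : Tendsto
      (fun m : ℕ => ((m : ℝ) ^ 2)⁻¹ * ∑ k ∈ Finset.Ico (m ^ 2) ((m + 1) ^ 2), ‖u k‖) atTop (𝓝 0)) :
    Tendsto (fun n : ℕ => (n : ℝ)⁻¹ • ∑ k ∈ Finset.range n, u k) atTop (𝓝 0) := by
  have hsqrt : Tendsto Nat.sqrt atTop atTop :=
    tendsto_atTop_atTop.2 fun b => ⟨b * b, fun _ hn => Nat.le_sqrt.2 hn⟩
  have hbound := (hsq.norm.add hblock).comp hsqrt
  rw [norm_zero, add_zero] at hbound
  refine squeeze_zero_norm' ?_ hbound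
  filter_upwards [eventually_gt_atTop 0] with n hn
  have : (0 : ℝ) < (n.sqrt : ℝ) ^ 2 := by exact_mod_cast pow_pos (Nat.sqrt_pos.2 hn) 2
  have hle : (n.sqrt : ℝ) ^ 2 ≤ n := by exact_mod_cast n.sqrt_le'
  simp only [Function.comp_apply, norm_smul, norm_inv, norm_pow, RCLike.norm_natCast]
  rw [← mul_add]
  gcongr
  exact norm_sum_range_le_norm_sum_range_sqrt_sq u n

theorem tendsto_average_of_tendsto_average_add_coboundary [NormedAddCommGroup E] [NormedSpace ℝ E]
    {a b : ℕ → E} {m : E} (hb : BddAbove (Set.range fun n => ‖b n‖))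
    (h : Tendsto (fun n : ℕ => (n : ℝ)⁻¹ • ∑ k ∈ Finset.range n, (a k - m + (b (k + 1) - b k)))
      atTop (𝓝 0)) :
    Tendsto (fun n : ℕ => (n : ℝ)⁻¹ • ∑ k ∈ Finset.range n, a k) atTop (𝓝 m) := by
  obtain ⟨B, hB⟩ := hb
  have hboundary : Tendsto (fun n : ℕ => (n : ℝ)⁻¹ • (b n - b 0)) atTop (𝓝 0) := by
    refine tendsto_inv_atTop_nhds_zero_nat.zero_smul_isBoundedUnder_le
      (isBoundedUnder_of ⟨B + B, fun n => ?_⟩)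
    exact (norm_sub_le _ _).trans (add_le_add (hB ⟨n, rfl⟩) (hB ⟨0, rfl⟩))
  have hlim := (h.sub hboundary).add_const m
  rw [sub_zero, zero_add] at hlim
  refine hlim.congr' ?_
  filter_upwards [eventually_ne_atTop 0] with n hn
  rw [Finset.sum_add_distrib, Finset.sum_range_sub, Finset.sum_sub_distrib, Finset.sum_const,
    Finset.card_range, ← Nat.cast_smul_eq_nsmul ℝ, smul_add, smul_sub,
    inv_smul_smul₀ (Nat.cast_ne_zero.2 hn)]
  abel

end Averages

section OrthogonalSLLN

variable {Ω ι E : Type*} [MeasurableSpace Ω] {μ : Measure Ω}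

theorem ae_tendsto_zero_of_summable_integral_norm [NormedAddCommGroup E] {Y : ℕ → Ω → E}
    (hY : ∀ n, Integrable (Y n) μ) (hsum : Summable fun n => ∫ ω, ‖Y n ω‖ ∂μ) :
    ∀ᵐ ω ∂μ, Tendsto (fun n => Y n ω) atTop (𝓝 0) := by
  have hmeas : ∀ n, AEMeasurable (fun ω => ‖Y n ω‖ₑ) μ := fun n => (hY n).1.enorm
  have hfin : ∫⁻ ω, ∑' n, ‖Y n ω‖ₑ ∂μ ≠ ⊤ := by
    simp only [lintegral_tsum hmeas, ← ofReal_integral_norm_eq_lintegral_enorm (hY _)]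
    exact hsum.tsum_ofReal_ne_top
  filter_upwards [ae_lt_top' (AEMeasurable.tsum hmeas) hfin] with ω hω
  exact tendsto_zero_iff_enorm_tendsto_zero.2 (ENNReal.tendsto_atTop_zero_of_tsum_ne_top hω.ne)

theorem ae_tendsto_zero_of_summable_integral_norm_sq [NormedAddCommGroup E] {Y : ℕ → Ω → E}
    (hY : ∀ n, MemLp (Y n) 2 μ) (hsum : Summable fun n => ∫ ω, ‖Y n ω‖ ^ 2 ∂μ) :
    ∀ᵐ ω ∂μ, Tendsto (fun n => Y n ω) atTop (𝓝 0) := by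
  have hsq := ae_tendsto_zero_of_summable_integral_norm (fun n => (hY n).norm.integrable_sq)
    (by simpa only [norm_pow, norm_norm] using hsum)
  filter_upwards [hsq] with ω hω
  refine tendsto_zero_iff_norm_tendsto_zero.2 ?_
  simpa only [Real.sqrt_sq (norm_nonneg _), Real.sqrt_zero] using hω.sqrt

theorem ae_tendsto_inv_sq_smul_of_integral_norm_sq_le [NormedAddCommGroup E] [NormedSpace ℝ E]
    {Y : ℕ → Ω → E} {C : ℝ} (hY : ∀ m, MemLp (Y m) 2 μ)
    (hC : ∀ m : ℕ, ∫ ω, ‖Y m ω‖ ^ 2 ∂μ ≤ C * (m + 1) ^ 2) :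
    ∀ᵐ ω ∂μ, Tendsto (fun m : ℕ => ((m : ℝ) ^ 2)⁻¹ • Y m ω) atTop (𝓝 0) := by
  have hC₀ : 0 ≤ C := (integral_nonneg fun _ => sq_nonneg _).trans (by simpa using hC 0)
  have hsummable : Summable fun m : ℕ => 4 * C * ((m : ℝ) ^ 2)⁻¹ :=
    (Real.summable_nat_pow_inv.2 one_lt_two).mul_left _
  refine ae_tendsto_zero_of_summable_integral_norm_sq (fun m => (hY m).const_smul _) <|
    hsummable.of_nonneg_of_le (fun m => integral_nonneg fun _ => sq_nonneg _) fun m => ?_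
  rcases m.eq_zero_or_pos with rfl | hm
  · simp
  have hm' : (1 : ℝ) ≤ m := by exact_mod_cast hm
  simp only [norm_smul, mul_pow, integral_const_mul, norm_inv, norm_pow, RCLike.norm_natCast]
  calc (((m : ℝ) ^ 2)⁻¹) ^ 2 * ∫ ω, ‖Y m ω‖ ^ 2 ∂μ
      ≤ (((m : ℝ) ^ 2)⁻¹) ^ 2 * (C * (m + m) ^ 2) := by
        gcongr
        exact (hC m).trans (by gcongr)
    _ = 4 * C * ((m : ℝ) ^ 2)⁻¹ := by
        field_simp
        ring

theorem integral_sum_norm_sq_le [NormedAddCommGroup E] {d : ι → Ω → E}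
    (hd : ∀ k, MemLp (d k) 2 μ) (s : Finset ι) :
    ∫ ω, (∑ k ∈ s, ‖d k ω‖) ^ 2 ∂μ ≤ s.card * ∑ k ∈ s, ∫ ω, ‖d k ω‖ ^ 2 ∂μ := by
  have hint : ∀ k ∈ s, Integrable (fun ω => ‖d k ω‖ ^ 2) μ := fun k _ => (hd k).norm.integrable_sq
  rw [← integral_finsetSum s hint, ← integral_const_mul]
  exact integral_mono (memLp_finsetSum s fun k _ => (hd k).norm).integrable_sq
    ((integrable_finsetSum s hint).const_mul _) fun ω => sq_sum_le_card_mul_sum_sq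

theorem integral_norm_sum_sq_of_orthogonal [NormedAddCommGroup E] [InnerProductSpace ℝ E]
    {d : ι → Ω → E} (hd : ∀ k, MemLp (d k) 2 μ)
    (horth : Pairwise fun j k => ∫ ω, inner ℝ (d j ω) (d k ω) ∂μ = 0) (s : Finset ι) :
    ∫ ω, ‖∑ k ∈ s, d k ω‖ ^ 2 ∂μ = ∑ k ∈ s, ∫ ω, ‖d k ω‖ ^ 2 ∂μ := by
  have hint : ∀ j k, Integrable (fun ω => inner ℝ (d j ω) (d k ω)) μ := fun j k =>
    ((hd j).norm.integrable_mul (hd k).norm).mono' ((hd j).1.inner (hd k).1)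
      (.of_forall fun _ => norm_inner_le_norm _ _)
  simp only [← real_inner_self_eq_norm_sq, sum_inner, inner_sum]
  rw [integral_finsetSum s fun k _ => integrable_finsetSum s fun j _ => hint j k]
  refine Finset.sum_congr rfl fun k hk => ?_
  rw [integral_finsetSum s fun j _ => hint j k]
  exact Finset.sum_eq_single_of_mem k hk fun j _ hjk => horth hjk

theorem ae_tendsto_average_zero_of_orthogonal [NormedAddCommGroup E] [InnerProductSpace ℝ E]
    {d : ℕ → Ω → E} {C : ℝ} (hd : ∀ k, MemLp (d k) 2 μ)
    (horth : Pairwise fun j k => ∫ ω, inner ℝ (d j ω) (d k ω) ∂μ = 0)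
    (hC : ∀ k, ∫ ω, ‖d k ω‖ ^ 2 ∂μ ≤ C) :
    ∀ᵐ ω ∂μ, Tendsto (fun n : ℕ => (n : ℝ)⁻¹ • ∑ k ∈ Finset.range n, d k ω) atTop (𝓝 0) := by
  have hC₀ : 0 ≤ C := (integral_nonneg fun _ => sq_nonneg _).trans (hC 0)
  have hsum_le (s : Finset ℕ) : ∑ k ∈ s, ∫ ω, ‖d k ω‖ ^ 2 ∂μ ≤ s.card * C := by
    simpa only [nsmul_eq_mul] using Finset.sum_le_card_nsmul s _ C fun k _ => hC k
  have hsq := ae_tendsto_inv_sq_smul_of_integral_norm_sq_le (C := C)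
    (Y := fun m ω => ∑ k ∈ Finset.range (m ^ 2), d k ω)
    (fun m => memLp_finsetSum _ fun k _ => hd k) fun m => by
      rw [integral_norm_sum_sq_of_orthogonal hd horth]
      refine (hsum_le _).trans ?_
      rw [Finset.card_range, mul_comm]
      push_cast
      gcongr
      linarith
  have hblock := ae_tendsto_inv_sq_smul_of_integral_norm_sq_le (C := 4 * C)
    (Y := fun m ω => ∑ k ∈ Finset.Ico (m ^ 2) ((m + 1) ^ 2), ‖d k ω‖)
    (fun m => memLp_finsetSum _ fun k _ => (hd k).norm) fun m => by
      have hcard : ((Finset.Ico (m ^ 2) ((m + 1) ^ 2)).card : ℝ) = 2 * m + 1 := by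
        rw [Nat.card_Ico, Nat.cast_sub (by gcongr; lia)]
        push_cast
        ring
      simp only [Real.norm_eq_abs, sq_abs]
      calc ∫ ω, (∑ k ∈ Finset.Ico (m ^ 2) ((m + 1) ^ 2), ‖d k ω‖) ^ 2 ∂μ
          ≤ (2 * m + 1) * ((2 * m + 1) * C) := by
            refine (integral_sum_norm_sq_le hd _).trans ?_
            rw [← hcard]
            gcongr
            exact hsum_le _
        _ = C * (2 * m + 1) ^ 2 := by ring
        _ ≤ C * (2 * (m + 1)) ^ 2 := by gcongr; linarith
        _ = 4 * C * (m + 1) ^ 2 := by ring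
  filter_upwards [hsq, hblock] with ω hω hω'
  exact tendsto_average_zero_of_tendsto_sq hω hω'

end OrthogonalSLLN

section MarkovChain

variable {S Ω E : Type*} [MeasurableSpace S] [MeasurableSpace Ω] {P : Matrix S S ℝ}
  {μ : Measure Ω} {X : ℕ → Ω → S}

/-- The history `(X 0, …, X n)` of the process `X` up to time `n`. -/
def history (X : ℕ → Ω → S) (n : ℕ) (ω : Ω) : Fin (n + 1) → S := fun k => X k ω

theorem IsMarkovChain.measurable_history (hX : IsMarkovChain P μ X) (n : ℕ) :
    Measurable (history X n) :=
  measurable_pi_lambda _ fun k => hX.measurable k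

theorem IsMarkovChain.measureReal_history_eq_and_eq (hX : IsMarkovChain P μ X) (n : ℕ)
    (x : Fin (n + 1) → S) (j : S) :
    μ.real {ω | history X n ω = x ∧ X (n + 1) ω = j} =
      μ.real {ω | history X n ω = x} * P (x (Fin.last n)) j := by
  let y : ℕ → S := fun k => if hk : k < n + 1 then x ⟨k, hk⟩ else j
  have hpast : ∀ ω, (∀ k ≤ n, X k ω = y k) ↔ history X n ω = x := fun ω => by
    simp only [← Nat.lt_succ_iff, funext_iff, Fin.forall_iff, history]
    exact forall₂_congr fun k hk => by rw [show y k = x ⟨k, hk⟩ from dif_pos hk]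
  have hlast : y n = x (Fin.last n) := dif_pos n.lt_succ_self
  have hnext : y (n + 1) = j := dif_neg (lt_irrefl _)
  have hmarkov := hX.markov n y
  simp only [Nat.le_succ_iff, or_imp, forall_and, forall_eq, hpast, hlast, hnext] at hmarkov
  exact hmarkov

variable [Fintype S] [MeasurableSingletonClass S] [IsFiniteMeasure μ]

theorem IsMarkovChain.integral_history_next_eq [NormedAddCommGroup E] [NormedSpace ℝ E]
    [CompleteSpace E] (hX : IsMarkovChain P μ X) (n : ℕ) (F : (Fin (n + 1) → S) → S → E) :
    ∫ ω, F (history X n ω) (X (n + 1) ω) ∂μ =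
      ∫ ω, ∑ j, P (X n ω) j • F (history X n ω) j ∂μ := by
  have hhist := hX.measurable_history n
  have hpair : Measurable fun ω => (history X n ω, X (n + 1) ω) :=
    hhist.prodMk (hX.measurable (n + 1))
  calc ∫ ω, F (history X n ω) (X (n + 1) ω) ∂μ
      = ∫ z, F z.1 z.2 ∂(μ.map fun ω => (history X n ω, X (n + 1) ω)) :=
        (integral_map (f := fun z : (Fin (n + 1) → S) × S => F z.1 z.2) hpair.aemeasurable
          .of_discrete).symm
    _ = ∑ x, ∑ j, μ.real {ω | history X n ω = x ∧ X (n + 1) ω = j} • F x j := by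
        rw [integral_fintype .of_finite, Fintype.sum_prod_type]
        simp only [map_measureReal_apply hpair (measurableSet_singleton _), Set.preimage,
          Set.mem_singleton_iff, Prod.mk.injEq]
    _ = ∑ x, μ.real {ω | history X n ω = x} • ∑ j, P (x (Fin.last n)) j • F x j := by
        simp only [hX.measureReal_history_eq_and_eq, mul_smul, Finset.smul_sum]
    _ = ∫ x, ∑ j, P (x (Fin.last n)) j • F x j ∂(μ.map (history X n)) := by
        rw [integral_fintype .of_finite]
        simp only [map_measureReal_apply hhist (measurableSet_singleton _), Set.preimage,
          Set.mem_singleton_iff]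
    _ = ∫ ω, ∑ j, P (X n ω) j • F (history X n ω) j ∂μ :=
        integral_map hhist.aemeasurable .of_discrete

variable [NormedAddCommGroup E] [InnerProductSpace ℝ E] {h : S → S → E}

theorem IsMarkovChain.integral_inner_transition_eq_zero (hX : IsMarkovChain P μ X)
    (hh : ∀ i, ∑ j, P i j • h i j = 0) {m n : ℕ} (hmn : m < n) :
    ∫ ω, inner ℝ (h (X m ω) (X (m + 1) ω)) (h (X n ω) (X (n + 1) ω)) ∂μ = 0 := by
  let F (x : Fin (n + 1) → S) (j : S) : ℝ :=
    inner ℝ (h (x ⟨m, by lia⟩) (x ⟨m + 1, by lia⟩)) (h (x (Fin.last n)) j)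
  calc ∫ ω, inner ℝ (h (X m ω) (X (m + 1) ω)) (h (X n ω) (X (n + 1) ω)) ∂μ
      = ∫ ω, ∑ j, P (X n ω) j • F (history X n ω) j ∂μ := hX.integral_history_next_eq n F
    _ = ∫ ω, inner ℝ (h (X m ω) (X (m + 1) ω)) (∑ j, P (X n ω) j • h (X n ω) j) ∂μ := by
        simp only [inner_sum, inner_smul_right]
        rfl
    _ = 0 := by simp only [hh, inner_zero_right, integral_zero]

theorem IsMarkovChain.ae_tendsto_average_transition_zero (hX : IsMarkovChain P μ X)
    (hh : ∀ i, ∑ j, P i j • h i j = 0) :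
    ∀ᵐ ω ∂μ, Tendsto
      (fun n : ℕ => (n : ℝ)⁻¹ • ∑ k ∈ Finset.range n, h (X k ω) (X (k + 1) ω)) atTop (𝓝 0) := by
  obtain ⟨B, hB⟩ := (Set.finite_range fun p : S × S => ‖h p.1 p.2‖).bddAbove
  have hbound : ∀ i j, ‖h i j‖ ≤ B := fun i j => hB ⟨(i, j), rfl⟩
  have hmem : ∀ k, MemLp (fun ω => h (X k ω) (X (k + 1) ω)) 2 μ := fun k =>
    .of_bound ((StronglyMeasurable.of_discrete (f := fun p : S × S => h p.1 p.2)).comp_measurable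
      ((hX.measurable k).prodMk (hX.measurable (k + 1)))).aestronglyMeasurable B
      (.of_forall fun _ => hbound _ _)
  refine ae_tendsto_average_zero_of_orthogonal (C := ∫ _, B ^ 2 ∂μ) hmem (fun m n hmn => ?_)
    fun k => ?_
  · rcases hmn.lt_or_gt with hlt | hgt
    · exact hX.integral_inner_transition_eq_zero hh hlt
    · simpa only [real_inner_comm] using hX.integral_inner_transition_eq_zero hh hgt
  · exact integral_mono (hmem k).norm.integrable_sq (integrable_const _) fun _ => by
      gcongr
      exact hbound _ _

theorem IsMarkovChain.ae_tendsto_cumulativePayoff [DecidableEq S] (hX : IsMarkovChain P μ X)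
    (hP : P ∈ Matrix.rowStochastic ℝ S) (hL : HasLiouvilleProperty P)
    {π : S → ℝ} (hπ : IsStationary P π) (W : Matrix S S ℝ) :
    ∀ᵐ ω ∂μ, Tendsto (fun n : ℕ => (n : ℝ)⁻¹ * cumulativePayoff W X n ω) atTop
      (𝓝 (meanPayoff P W π)) := by
  obtain ⟨g, hg⟩ := exists_poisson_solution hL hπ ((P ⊙ W) *ᵥ 1)
  have hcenter : ∀ i, ∑ j, P i j • (W i j - meanPayoff P W π + (g j - g i)) = 0 := fun i => by
    have hgi : g i - ∑ j, P i j * g j = ∑ j, P i j * W i j - meanPayoff P W π := by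
      simpa [Matrix.mulVec, dotProduct, meanPayoff] using congrFun hg i
    simp only [smul_eq_mul, mul_add, mul_sub, Finset.sum_add_distrib, Finset.sum_sub_distrib,
      ← Finset.sum_mul, Matrix.sum_row_of_mem_rowStochastic hP]
    linarith
  filter_upwards [hX.ae_tendsto_average_transition_zero hcenter] with ω hω
  refine tendsto_average_of_tendsto_average_add_coboundary (b := fun n => g (X n ω)) ?_ hω
  exact ((Set.finite_range fun i => |g i|).subset
    (Set.range_comp_subset_range (fun n => X n ω) fun i => |g i|)).bddAbove

end MarkovChain

end FiniteMarkov

theorem theorem8_general {S : Type*} [Fintype S] [DecidableEq S] [Nonempty S] [MeasurableSpace S]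
    [MeasurableSingletonClass S] (P : Matrix S S ℝ) (hP : P ∈ Matrix.rowStochastic ℝ S)
    (hL : FiniteMarkov.HasLiouvilleProperty P) :
    (∃! π : S → ℝ, FiniteMarkov.IsStationary P π) ∧
    ∀ (π : S → ℝ), FiniteMarkov.IsStationary P π →
      ∀ (W : Matrix S S ℝ) {Ω : Type*} [MeasurableSpace Ω] (μ : Measure Ω)
        [IsFiniteMeasure μ] (X : ℕ → Ω → S), FiniteMarkov.IsMarkovChain P μ X →
        ∀ᵐ ω ∂μ, Tendsto (fun n : ℕ => (n : ℝ)⁻¹ * FiniteMarkov.cumulativePayoff W X n ω)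
          atTop (𝓝 (FiniteMarkov.meanPayoff P W π)) :=
  ⟨FiniteMarkov.existsUnique_isStationary hP hL,
    fun _ hπ W _ _ _ _ _ hX => hX.ae_tendsto_cumulativePayoff hP hL hπ W⟩

theorem theorem8 {S : Type*} [Fintype S] [DecidableEq S] [Nonempty S] [MeasurableSpace S]
    [MeasurableSingletonClass S] (P : Matrix S S ℝ) (hP : P ∈ Matrix.rowStochastic ℝ S)
    (hirr : P.IsIrreducible) (hper : FiniteMarkov.HasPeriod P 2) :
    (∃! π : S → ℝ, FiniteMarkov.IsStationary P π) ∧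
    ∀ (π : S → ℝ), FiniteMarkov.IsStationary P π →
      ∀ (W : Matrix S S ℝ) {Ω : Type*} [MeasurableSpace Ω] (μ : Measure Ω)
        [IsProbabilityMeasure μ] (X : ℕ → Ω → S), FiniteMarkov.IsMarkovChain P μ X →
        ∀ᵐ ω ∂μ, Tendsto (fun n : ℕ => (n : ℝ)⁻¹ * FiniteMarkov.cumulativePayoff W X n ω)
          atTop (𝓝 (FiniteMarkov.meanPayoff P W π)) := by
  obtain ⟨hunique, hslln⟩ :=
    theorem8_general P hP (FiniteMarkov.hasLiouvilleProperty_of_isIrreducible hP hirr)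
  exact ⟨hunique, fun π hπ W _ _ μ _ X hX => hslln π hπ W μ X hX⟩
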